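/- Let $n\ge 1$, and let $B^n(0,r)=\{z\in\mathbb{C}^n : \|z\|<r\}$ be the open Euclidean ball, $B^n=B^n(0,1)$. Let $D\subset\mathbb{C}^n$ be a bounded domain (a nonempty, connected, bounded open set). A holomorphic embedding $f:D\to B^n$ is a holomorphic immersion with values in $B^n$ that is a homeomorphism of $D$ onto an open subset $f(D)$ of $B^n$. For $x\in D$ and such an $f$ with $f(x)=0$ put $$s_D(x,f)=\sup\{r\in\mathbb{R} : B^n(0,r)\subset f(D)\},\qquad s_D(x)=\sup_f s_D(x,f),$$ where the last supremum is over all holomorphic embeddings $f:D\to B^n$ with $f(x)=0$. (1) For every $x\in D$ the supremum defining $s_D(x)$ is attained: there is a holomorphic embedding $f:D\to B^n$ with $f(x)=0$, $B^n(0,s_D(x))\subset f(D)$, and $s_D(x,f)=s_D(x)$. (2) Consequently, there is a point $x\in D$ with $s_D(x)=1$ if and only if $D$ is biholomorphic to $B^n$ (that is, there is a holomorphic bijection $D\to B^n$ with holomorphic inverse). -/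

import Mathlib

open Set Metric

/-- A domain in `ℂⁿ` (with its Euclidean norm): a nonempty, open, connected set. -/
def IsComplexDomain {n : ℕ} (D : Set (EuclideanSpace ℂ (Fin n))) : Prop :=
  IsOpen D ∧ IsConnected D

/-- An (open) holomorphic embedding `f : D → Ω` between open subsets of `ℂⁿ`: a holomorphic
immersion which is a homeomorphism of `D` onto an open set contained in `Ω`.
The values of `f` outside `D` are irrelevant. -/
structure IsHolomorphicEmbedding {n : ℕ} (D Ω : Set (EuclideanSpace ℂ (Fin n)))
    (f : EuclideanSpace ℂ (Fin n) → EuclideanSpace ℂ (Fin n)) : Prop where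
  holomorphic : DifferentiableOn ℂ f D
  immersive : ∀ z ∈ D, Function.Injective (fderiv ℂ f z)
  isOpenEmbedding : Topology.IsOpenEmbedding (D.domRestrict f)
  mapsTo : MapsTo f D Ω

/-- Two open subsets of `ℂⁿ` are holomorphically equivalent (biholomorphic). -/
def HolomorphicallyEquivalent {n : ℕ} (D Ω : Set (EuclideanSpace ℂ (Fin n))) : Prop :=
  ∃ f g : EuclideanSpace ℂ (Fin n) → EuclideanSpace ℂ (Fin n),
    DifferentiableOn ℂ f D ∧ DifferentiableOn ℂ g Ω ∧
      MapsTo f D Ω ∧ MapsTo g Ω D ∧ InvOn g f D Ω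

/-- The number `s_D(p, f) = sup {r | Bⁿ(0, r) ⊆ f(D)}`. -/
noncomputable def innerRadius {n : ℕ} (D : Set (EuclideanSpace ℂ (Fin n)))
    (f : EuclideanSpace ℂ (Fin n) → EuclideanSpace ℂ (Fin n)) : ℝ :=
  sSup {r : ℝ | ball (0 : EuclideanSpace ℂ (Fin n)) r ⊆ f '' D}

/-- The numbers `s_D(p, f)`, where `f` runs over the holomorphic embeddings of `D` into the open
unit ball with `f p = 0`. -/
def innerRadii {n : ℕ} (D : Set (EuclideanSpace ℂ (Fin n))) (p : EuclideanSpace ℂ (Fin n)) :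
    Set ℝ :=
  {s : ℝ | ∃ f : EuclideanSpace ℂ (Fin n) → EuclideanSpace ℂ (Fin n),
    IsHolomorphicEmbedding D (ball 0 1) f ∧ f p = 0 ∧ s = innerRadius D f}

/-- The squeezing function `s_D(p) = sup_f s_D(p, f)`. -/
noncomputable def squeezingFunction {n : ℕ} (D : Set (EuclideanSpace ℂ (Fin n)))
    (p : EuclideanSpace ℂ (Fin n)) : ℝ :=
  sSup (innerRadii D p)

/-! The suprema above are taken over nonempty sets of reals that are bounded above. -/

theorem le_one_of_ball_subset {n : ℕ} (hn : 0 < n) {r : ℝ}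
    (h : ball (0 : EuclideanSpace ℂ (Fin n)) r ⊆ ball 0 1) : r ≤ 1 := by
  by_contra! hr
  have h1 : EuclideanSpace.single (⟨0, hn⟩ : Fin n) (1 : ℂ) ∈
      ball (0 : EuclideanSpace ℂ (Fin n)) r := by
    simpa using hr
  simpa using h h1

theorem isLUB_innerRadius {n : ℕ} (hn : 0 < n) {D : Set (EuclideanSpace ℂ (Fin n))}
    {f : EuclideanSpace ℂ (Fin n) → EuclideanSpace ℂ (Fin n)}
    (hf : IsHolomorphicEmbedding D (ball 0 1) f) :
    IsLUB {r : ℝ | ball (0 : EuclideanSpace ℂ (Fin n)) r ⊆ f '' D} (innerRadius D f) :=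
  isLUB_csSup ⟨0, by simp⟩
    ⟨1, fun _ hr => le_one_of_ball_subset hn (Subset.trans hr hf.mapsTo.image_subset)⟩

theorem innerRadius_le_one {n : ℕ} (hn : 0 < n) {D : Set (EuclideanSpace ℂ (Fin n))}
    {f : EuclideanSpace ℂ (Fin n) → EuclideanSpace ℂ (Fin n)}
    (hf : IsHolomorphicEmbedding D (ball 0 1) f) : innerRadius D f ≤ 1 :=
  (isLUB_innerRadius hn hf).2
    fun _ hr => le_one_of_ball_subset hn (Subset.trans hr hf.mapsTo.image_subset)

theorem innerRadii_nonempty {n : ℕ} {D : Set (EuclideanSpace ℂ (Fin n))} (hD : IsOpen D)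
    (hb : Bornology.IsBounded D) (p : EuclideanSpace ℂ (Fin n)) : (innerRadii D p).Nonempty := by
  obtain ⟨R, hR, hDR⟩ := hb.subset_ball_lt 0 p
  have hc : ((R : ℂ)⁻¹) ≠ 0 := inv_ne_zero (Complex.ofReal_ne_zero.2 hR.ne')
  refine ⟨_, fun z => (R : ℂ)⁻¹ • (z - p), ⟨by fun_prop, ?_, ?_, ?_⟩, by simp, rfl⟩
  · intro z _
    have hd : HasFDerivAt (fun z => (R : ℂ)⁻¹ • (z - p))
        ((R : ℂ)⁻¹ • ContinuousLinearMap.id ℂ (EuclideanSpace ℂ (Fin n))) z :=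
      ((hasFDerivAt_id (𝕜 := ℂ) z).sub_const p).const_smul (R : ℂ)⁻¹
    rw [hd.fderiv]
    intro a b hab
    simpa [hc, hR.ne'] using hab
  · exact ((Homeomorph.smulOfNeZero _ hc).isOpenEmbedding.comp
      (Homeomorph.subRight p).isOpenEmbedding).comp hD.isOpenEmbedding_subtypeVal
  · intro z hz
    have := hDR hz
    rw [mem_ball, dist_eq_norm] at this
    simp only [mem_ball, dist_zero_right, norm_smul, norm_inv, Complex.norm_real, Real.norm_eq_abs,
      abs_of_pos hR]
    rw [inv_mul_lt_iff₀ hR]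
    simpa using this

theorem isLUB_squeezingFunction {n : ℕ} (hn : 0 < n) {D : Set (EuclideanSpace ℂ (Fin n))}
    (hD : IsOpen D) (hb : Bornology.IsBounded D) (p : EuclideanSpace ℂ (Fin n)) :
    IsLUB (innerRadii D p) (squeezingFunction D p) :=
  isLUB_csSup (innerRadii_nonempty hD hb p)
    ⟨1, by rintro _ ⟨f, hf, -, rfl⟩; exact innerRadius_le_one hn hf⟩

/-! ### Limits of locally bounded holomorphic maps. -/

section BoundedHolomorphic

open Filter Topology

variable {ι E G : Type*} [NormedAddCommGroup E] [NormedSpace ℂ E]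
  [NormedAddCommGroup G] [NormedSpace ℂ G]

/-! Choose embeddings `F k` of `D` into the unit ball, sending `x` to `0`, whose inner radii tend to
the supremum `s`. The maps `F k` are bounded by `1`, and their inverses, defined eventually on every
ball of radius less than `s`, take values in the bounded set `D`. Hence both families are normal;
limits along one ultrafilter `𝒰` take the place of repeated passage to subsequences and give
holomorphic limits `f` on `D` and `G` on the ball of radius `s`.

Derivatives converge as well, so the derivatives of `f` at `x` and of `G` at `0` are mutually
inverse. Hurwitz's theorem, applied to Jacobian determinants (`injective_fderiv_of_isPreconnected`),
spreads nondegeneracy over the two connected domains. A quantitative inverse function theorem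
uniform in `k` (`EventuallyBoundedHolomorphicAt.closedBall_subset_image`) then shows that `f` is
injective and open, and that `G` takes values in `D` rather than only in its closure. Finally `f ∘ G
= id`, so the image of `f` contains the ball of radius `s`. If `s = 1`, this image is the whole unit
ball. -/

theorem norm_fderiv_le_of_bounded_ball {f : E → G} {a : E} {r C : ℝ} (hr : 0 < r)
    (hd : DifferentiableOn ℂ f (ball a r)) (hC : ∀ z ∈ ball a r, ‖f z‖ ≤ C) :
    ‖fderiv ℂ f a‖ ≤ 2 * C / r := by
  refine Complex.norm_fderiv_le_div_of_mapsTo_ball hd (fun z hz => ?_) hr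
  rw [mem_closedBall, dist_eq_norm]
  linarith [norm_sub_le (f z) (f a), hC z hz, hC a (mem_ball_self hr)]

/-- A Taylor estimate of order two for a bounded holomorphic map on a ball. -/
theorem norm_sub_fderiv_le_of_bounded_ball {f : E → G} {a z : E} {r C : ℝ}
    (hd : DifferentiableOn ℂ f (ball a r)) (hC : ∀ z ∈ ball a r, ‖f z‖ ≤ C) (hz : z ∈ ball a r) :
    ‖f z - f a - fderiv ℂ f a (z - a)‖ ≤ 4 * C * (‖z - a‖ / r) ^ 2 := by
  have hr : 0 < r := pos_of_mem_ball hz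
  have hfa : HasFDerivAt f (fderiv ℂ f a) a :=
    (hd.differentiableAt (ball_mem_nhds a hr)).hasFDerivAt
  set A := fderiv ℂ f a with hA
  have hAn : ‖A‖ ≤ 2 * C / r := norm_fderiv_le_of_bounded_ball hr hd hC
  -- Higher-order Schwarz lemma for the remainder, which is `o(‖w - a‖)` at `a`. The bound `4 * C`
  -- is `2 * C` from `f w - f a` plus `2 * C` from the linear term.
  have key := Complex.dist_le_mul_div_pow_of_mapsTo_ball_of_isLittleO
    (f := fun w => f w - A (w - a)) (R₂ := 4 * C) (n := 1)
    (hd.sub (by fun_prop)) (fun w hw => ?_) ?_ hz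
  · simpa [dist_eq_norm, sub_right_comm] using key
  · have h1 : ‖A (w - a)‖ ≤ 2 * C / r * r := by
      refine (A.le_opNorm _).trans ?_
      have := mem_ball_iff_norm.1 hw
      have := (norm_nonneg A).trans hAn
      gcongr
    rw [div_mul_cancel₀ _ hr.ne'] at h1
    simp only [sub_self, map_zero, sub_zero, mem_closedBall, dist_eq_norm]
    have h2 := norm_sub_le (f w - f a) (A (w - a))
    rw [sub_right_comm] at h2
    linarith [norm_sub_le (f w) (f a), hC w hw, hC a (mem_ball_self hr)]
  · have := hfa.isLittleO.norm_right
    simp only [pow_one]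
    refine this.congr_left fun w => ?_
    simp only [sub_self, map_zero, sub_zero]
    abel

/-- The derivative of a bounded holomorphic map is Lipschitz at the centre of the ball. -/
theorem norm_fderiv_sub_le_of_bounded_ball {f : E → G} {a z : E} {r C : ℝ} (hr : 0 < r)
    (hd : DifferentiableOn ℂ f (ball a r)) (hC : ∀ z ∈ ball a r, ‖f z‖ ≤ C)
    (hz : ‖z - a‖ ≤ r / 2) :
    ‖fderiv ℂ f z - fderiv ℂ f a‖ ≤ 32 * C / r ^ 2 * ‖z - a‖ := by
  rcases eq_or_ne z a with rfl | hza
  · simp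
  have hρ : 0 < ‖z - a‖ := norm_pos_iff.2 (sub_ne_zero.2 hza)
  set A := fderiv ℂ f a with hA
  have hsub : ball z ‖z - a‖ ⊆ ball a r := ball_subset_ball' (by
    rw [dist_eq_norm]; linarith)
  have hC0 : 0 ≤ C := (norm_nonneg _).trans (hC a (mem_ball_self hr))
  -- On the ball of radius `‖z - a‖` about `z` the Taylor remainder is quadratic in that radius; the
  -- Cauchy estimate divides by the radius once, leaving a linear bound.
  have hT : ∀ w ∈ ball z ‖z - a‖,
      ‖f w - f a - A (w - a)‖ ≤ 4 * C * (2 * ‖z - a‖ / r) ^ 2 := fun w hw => by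
    refine (norm_sub_fderiv_le_of_bounded_ball hd hC (hsub hw)).trans ?_
    have : ‖w - a‖ ≤ 2 * ‖z - a‖ := by
      have := norm_sub_le_norm_sub_add_norm_sub w z a
      rw [mem_ball_iff_norm] at hw
      linarith
    gcongr
  have hz' : z ∈ ball a r := hsub (mem_ball_self hρ)
  have hfz : DifferentiableAt ℂ f z := hd.differentiableAt (isOpen_ball.mem_nhds hz')
  have hd2 : HasFDerivAt (fun w => f w - f a - A (w - a)) (fderiv ℂ f z - A) z := by
    simp only [map_sub]
    exact (hfz.hasFDerivAt.sub_const (f a)).sub (A.hasFDerivAt.sub_const (A a))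
  have := norm_fderiv_le_of_bounded_ball hρ
    (((hd.mono hsub).sub_const (f a)).fun_sub (by fun_prop :
      DifferentiableOn ℂ (fun w => A (w - a)) (ball z ‖z - a‖))) hT
  rw [hd2.fderiv] at this
  refine this.trans_eq ?_
  field_simp
  ring

/-- Along `l`, the maps `F k` are eventually holomorphic and bounded by the same constant on
a fixed ball around `a`. -/
def EventuallyBoundedHolomorphicAt (l : Filter ι) (F : ι → E → G) (a : E) : Prop :=
  ∃ r > 0, ∃ C : ℝ, ∀ᶠ k in l, DifferentiableOn ℂ (F k) (ball a r) ∧ ∀ z ∈ ball a r, ‖F k z‖ ≤ C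

theorem eventuallyBoundedHolomorphicAt_const (l : Filter ι) {f : E → G} {U : Set E} {a : E} {C : ℝ}
    (hU : IsOpen U) (ha : a ∈ U) (hd : DifferentiableOn ℂ f U) (hC : ∀ z ∈ U, ‖f z‖ ≤ C) :
    EventuallyBoundedHolomorphicAt l (fun _ => f) a := by
  obtain ⟨r, hr, hrU⟩ := Metric.isOpen_iff.1 hU a ha
  exact ⟨r, hr, C, .of_forall fun _ => ⟨hd.mono hrU, fun z hz => hC z (hrU hz)⟩⟩

/-- Closed balls are compact in finite dimension, so every bounded family converges along an
ultrafilter. This is what replaces the extraction of subsequences. -/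
theorem exists_tendsto_ultrafilter_of_norm_le [FiniteDimensional ℂ G] (𝒰 : Ultrafilter ι)
    {u : ι → G} {C : ℝ} (h : ∀ᶠ k in (𝒰 : Filter ι), ‖u k‖ ≤ C) :
    ∃ w, Tendsto u 𝒰 (𝓝 w) := by
  have : ProperSpace G := FiniteDimensional.proper ℂ G
  obtain ⟨w, -, hw⟩ := (isCompact_closedBall (0 : G) C).ultrafilter_le_nhds (𝒰.map u)
    (by rw [Ultrafilter.coe_map, le_principal_iff, mem_map]
        exact h.mono fun k hk => by simpa using hk)
  exact ⟨w, hw⟩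

theorem EventuallyBoundedHolomorphicAt.exists_tendsto [FiniteDimensional ℂ G] {𝒰 : Ultrafilter ι}
    {F : ι → E → G} {a : E} (h : EventuallyBoundedHolomorphicAt (𝒰 : Filter ι) F a) :
    ∃ w, Tendsto (fun k => F k a) 𝒰 (𝓝 w) := by
  obtain ⟨r, hr, C, h⟩ := h
  exact exists_tendsto_ultrafilter_of_norm_le 𝒰 (h.mono fun k hk => hk.2 a (mem_ball_self hr))

/-- The second-order Taylor estimate has a constant independent of `k`, so it survives the pointwise
limit. -/
theorem EventuallyBoundedHolomorphicAt.hasFDerivAt_of_tendsto {l : Filter ι} [l.NeBot]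
    {F : ι → E → G} {f : E → G} {a : E} {A : E →L[ℂ] G}
    (h : EventuallyBoundedHolomorphicAt l F a)
    (hf : ∀ᶠ z in 𝓝 a, Tendsto (fun k => F k z) l (𝓝 (f z)))
    (hA : Tendsto (fun k => fderiv ℂ (F k) a) l (𝓝 A)) : HasFDerivAt f A a := by
  obtain ⟨r, hr, C, h⟩ := h
  have hbound : ∀ᶠ z in 𝓝 a, ‖f z - f a - A (z - a)‖ ≤ 4 * C / r ^ 2 * ‖z - a‖ ^ 2 := by
    filter_upwards [hf, ball_mem_nhds a hr] with z hz hzr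
    have hT : Tendsto (fun k => ‖F k z - F k a - fderiv ℂ (F k) a (z - a)‖) l
        (𝓝 ‖f z - f a - A (z - a)‖) :=
      ((hz.sub hf.self_of_nhds).sub
        (((ContinuousLinearMap.apply ℂ G (z - a)).continuous.tendsto A).comp hA)).norm
    refine le_of_tendsto hT (h.mono fun k hk => ?_)
    refine (norm_sub_fderiv_le_of_bounded_ball hk.1 hk.2 hzr).trans_eq ?_
    field_simp
  refine .of_isLittleO ?_
  refine (Asymptotics.IsBigO.of_bound (g := fun z => ‖z - a‖ ^ 2) (4 * C / r ^ 2)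
    (hbound.mono fun z hz => ?_)).trans_isLittleO ?_
  · simpa using hz
  · have h1 : (fun z => ‖z - a‖ ^ 2) =o[𝓝 a] fun z => ‖z - a‖ ^ 1 :=
      (Asymptotics.isLittleO_pow_pow (𝕜 := ℝ) one_lt_two).comp_tendsto
        (by simpa using (continuous_id.sub continuous_const).norm.tendsto' a (0:ℝ) (by simp))
    simpa using h1

/-- Pointwise limits along an ultrafilter of bounded holomorphic maps are holomorphic,
and the derivatives converge. -/
theorem EventuallyBoundedHolomorphicAt.differentiableAt_and_tendsto_fderiv [FiniteDimensional ℂ E]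
    [FiniteDimensional ℂ G] {𝒰 : Ultrafilter ι} {F : ι → E → G} {f : E → G} {a : E}
    (h : EventuallyBoundedHolomorphicAt (𝒰 : Filter ι) F a)
    (hf : ∀ᶠ z in 𝓝 a, Tendsto (fun k => F k z) 𝒰 (𝓝 (f z))) :
    DifferentiableAt ℂ f a ∧ Tendsto (fun k => fderiv ℂ (F k) a) 𝒰 (𝓝 (fderiv ℂ f a)) := by
  obtain ⟨r, hr, C, hb⟩ := id h
  obtain ⟨A, hA⟩ := exists_tendsto_ultrafilter_of_norm_le 𝒰
    (hb.mono fun k hk => norm_fderiv_le_of_bounded_ball hr hk.1 hk.2)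
  have hfA := h.hasFDerivAt_of_tendsto hf hA
  exact ⟨hfA.differentiableAt, by rwa [hfA.fderiv]⟩

/-- The Lipschitz constant depends only on `C` and `r`: bounded families are equicontinuous. -/
theorem norm_sub_le_of_bounded_ball {f : E → G} {a y z : E} {r C : ℝ}
    (hd : DifferentiableOn ℂ f (ball a r)) (hC : ∀ z ∈ ball a r, ‖f z‖ ≤ C)
    (hy : y ∈ ball a (r / 2)) (hz : z ∈ ball a (r / 2)) :
    ‖f z - f y‖ ≤ 4 * C / r * ‖z - y‖ := by
  have hr : 0 < r := by linarith [pos_of_mem_ball hy]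
  have hsub : ∀ w ∈ ball a (r / 2), ball w (r / 2) ⊆ ball a r := fun w hw =>
    ball_subset_ball' (by linarith [mem_ball.1 hw])
  refine Convex.norm_image_sub_le_of_norm_fderiv_le (𝕜 := ℂ) (fun w hw => ?_) (fun w hw => ?_)
    (convex_ball a (r / 2)) hy hz
  · exact hd.differentiableAt (isOpen_ball.mem_nhds (ball_subset_ball (by linarith) hw))
  · refine (norm_fderiv_le_of_bounded_ball (half_pos hr) (hd.mono (hsub w hw))
      fun u hu => hC u (hsub w hw hu)).trans_eq ?_
    field_simp
    ring

/-- Bounded holomorphic families converge continuously. -/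
theorem EventuallyBoundedHolomorphicAt.tendsto_prod {l : Filter ι} {F : ι → E → G} {a : E} {b : G}
    (h : EventuallyBoundedHolomorphicAt l F a) (hf : Tendsto (fun k => F k a) l (𝓝 b)) :
    Tendsto (fun p : ι × E => F p.1 p.2) (l ×ˢ 𝓝 a) (𝓝 b) := by
  obtain ⟨r, hr, C, h⟩ := h
  have h0 : Tendsto (fun p : ι × E => F p.1 p.2 - F p.1 a) (l ×ˢ 𝓝 a) (𝓝 0) := by
    refine squeeze_zero_norm' (a := fun p : ι × E => 4 * C / r * ‖p.2 - a‖) ?_ ?_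
    · filter_upwards [h.prod_mk (ball_mem_nhds a (half_pos hr))] with p hp
      exact norm_sub_le_of_bounded_ball hp.1.1 hp.1.2 (mem_ball_self (half_pos hr)) hp.2
    · have : Tendsto (fun z : E => 4 * C / r * ‖z - a‖) (𝓝 a) (𝓝 0) :=
        (by fun_prop : Continuous fun z : E => 4 * C / r * ‖z - a‖).tendsto' _ _ (by simp)
      exact this.comp tendsto_snd
  simpa using h0.add (hf.comp tendsto_fst)

/-- The directional derivatives of a bounded holomorphic map are holomorphic. -/
theorem differentiableAt_fderiv_apply_of_bounded_ball [FiniteDimensional ℂ E]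
    [FiniteDimensional ℂ G] {f : E → G} {a : E} {r C : ℝ} (hr : 0 < r)
    (hd : DifferentiableOn ℂ f (ball a r)) (hC : ∀ z ∈ ball a r, ‖f z‖ ≤ C) (e : E) :
    DifferentiableAt ℂ (fun z => fderiv ℂ f z e) a := by
  -- The directional derivative is the limit of the difference quotients as `t → 0`, `t ≠ 0`. These
  -- are holomorphic and uniformly bounded near `a`, so the limit theorem applies.
  let 𝒰 : Ultrafilter ℂ := Ultrafilter.of (𝓝[≠] 0)
  have h𝒰 : (𝒰 : Filter ℂ) ≤ 𝓝[≠] 0 := Ultrafilter.of_le _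
  have hsmall : ∀ᶠ t : ℂ in (𝒰 : Filter ℂ), ‖t • e‖ < r / 4 :=
    h𝒰.trans nhdsWithin_le_nhds (((continuous_id.smul continuous_const).norm.tendsto' (0 : ℂ) 0
      (by simp)).eventually_lt_const (by positivity))
  have hne : ∀ᶠ t : ℂ in (𝒰 : Filter ℂ), t ≠ 0 := h𝒰 self_mem_nhdsWithin
  have hb : EventuallyBoundedHolomorphicAt (𝒰 : Filter ℂ)
      (fun t z => t⁻¹ • (f (z + t • e) - f z)) a := by
    refine ⟨r / 4, by positivity, 4 * C / r * ‖e‖, ?_⟩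
    filter_upwards [hsmall, hne] with t ht ht0
    have hmem : ∀ z ∈ ball a (r / 4), z + t • e ∈ ball a (r / 2) := fun z hz => by
      rw [mem_ball_iff_norm] at hz ⊢
      rw [add_sub_right_comm]
      linarith [norm_add_le (z - a) (t • e)]
    refine ⟨?_, fun z hz => ?_⟩
    · refine ((hd.comp (by fun_prop) fun z hz => ball_subset_ball (by linarith) (hmem z hz)).sub
        (hd.mono (ball_subset_ball (by linarith)))).const_smul _
    · have := norm_sub_le_of_bounded_ball hd hC (ball_subset_ball (by linarith) hz) (hmem z hz)
      rw [add_sub_cancel_left, norm_smul] at this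
      rw [norm_smul, norm_inv, inv_mul_le_iff₀ (norm_pos_iff.2 ht0)]
      linarith
  refine (hb.differentiableAt_and_tendsto_fderiv ?_).1
  filter_upwards [ball_mem_nhds a hr] with z hz
  have hz' := (hd.differentiableAt (isOpen_ball.mem_nhds hz)).hasFDerivAt.hasLineDerivAt e
  exact hz'.tendsto_slope_zero.mono_left h𝒰

/-- Inverse function theorem with constants uniform in `k`: on a small ball all late `F k` are close
to the same invertible linear map `A`, hence cover a ball of fixed radius about `F k a`, and `F k a`
is close to `f a`. -/
theorem EventuallyBoundedHolomorphicAt.closedBall_subset_image [FiniteDimensional ℂ E]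
    {l : Filter ι} {F : ι → E → G} {f : E → G} {a : E} (A : E ≃L[ℂ] G)
    (h : EventuallyBoundedHolomorphicAt l F a) (hf : Tendsto (fun k => F k a) l (𝓝 (f a)))
    (hA : Tendsto (fun k => fderiv ℂ (F k) a) l (𝓝 A)) {ε : ℝ} (hε : 0 < ε) :
    ∃ δ > 0, ∀ᶠ k in l, closedBall (f a) δ ⊆ F k '' closedBall a ε := by
  have : CompleteSpace E := FiniteDimensional.complete ℂ E
  obtain ⟨r, hr, C, h⟩ := h
  let N : ContinuousLinearMap.NonlinearRightInverse (A : E →L[ℂ] G) :=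
    { toFun := A.symm
      -- The `+ 1` keeps the constant positive even when `E` is trivial.
      nnnorm := ‖(A.symm : G →L[ℂ] E)‖₊ + 1
      bound' := fun y => ((A.symm : G →L[ℂ] E).le_opNorm y).trans (by
        push_cast
        gcongr
        linarith)
      right_inv' := fun y => by simp }
  have hN : 0 < (N.nnnorm : ℝ)⁻¹ := by
    have : 0 < (N.nnnorm : ℝ) := by
      change 0 < ((‖(A.symm : G →L[ℂ] E)‖₊ + 1 : NNReal) : ℝ)
      positivity
    positivity
  -- With this choice `N.nnnorm⁻¹ - c = c`, so `F k` covers radius `c * η` about `F k a`; half of it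
  -- absorbs the distance from `F k a` to `f a`.
  set c : NNReal := N.nnnorm⁻¹ / 2 with hc
  have hc' : (c : ℝ) = (N.nnnorm : ℝ)⁻¹ / 2 := by simp [hc]
  have hc0 : 0 < (c : ℝ) := by rw [hc']; positivity
  -- The tolerance `c` is split: `c / 2` for the variation of the derivative over the ball, `c / 2`
  -- for its distance from `A` at the centre.
  obtain ⟨η, hη0, hηε, hηr, hηc⟩ : ∃ η > 0, η ≤ ε ∧ η ≤ r / 2 ∧ 32 * C / r ^ 2 * η ≤ c / 2 := by
    have h1 : ∀ᶠ η : ℝ in 𝓝[>] 0, 32 * C / r ^ 2 * η < c / 2 := nhdsWithin_le_nhds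
      (((by fun_prop : Continuous fun η : ℝ => 32 * C / r ^ 2 * η).tendsto' 0 0
        (by simp)).eventually_lt_const (by positivity))
    obtain ⟨η, h1, h2, h3, h4⟩ := (h1.and ((eventually_mem_nhdsWithin (a := (0:ℝ))).and
      ((eventually_le_nhds hε |>.filter_mono nhdsWithin_le_nhds).and
      (eventually_le_nhds (half_pos hr) |>.filter_mono nhdsWithin_le_nhds)))).exists
    exact ⟨η, h2, h3, h4, h1.le⟩
  refine ⟨c * η / 2, by positivity, ?_⟩
  filter_upwards [h, hf.eventually (closedBall_mem_nhds _ (by positivity : 0 < c * η / 2)),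
    hA.eventually (closedBall_mem_nhds _ (half_pos hc0))] with k ⟨hk, hkC⟩ hka hkA
  have hsub : closedBall a η ⊆ ball a r := closedBall_subset_ball (by linarith)
  have happ : ApproximatesLinearOn (F k) (A : E →L[ℂ] G) (closedBall a η) c := by
    rw [ApproximatesLinearOn.approximatesLinearOn_iff_lipschitzOnWith]
    refine Convex.lipschitzOnWith_of_nnnorm_hasFDerivWithin_le (𝕜 := ℂ)
      (f' := fun z => fderiv ℂ (F k) z - (A : E →L[ℂ] G)) (fun z hz => ?_) (fun z hz => ?_)
      (convex_closedBall a η)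
    · exact ((hk.differentiableAt (isOpen_ball.mem_nhds (hsub hz))).hasFDerivAt.sub
        (A : E →L[ℂ] G).hasFDerivAt).hasFDerivWithinAt
    · rw [← NNReal.coe_le_coe, coe_nnnorm]
      have hz' : ‖z - a‖ ≤ η := mem_closedBall_iff_norm.1 hz
      have h1 := norm_fderiv_sub_le_of_bounded_ball hr hk hkC (hz'.trans hηr)
      have hC0 : 0 ≤ C := (norm_nonneg _).trans (hkC a (mem_ball_self hr))
      have h2 : 32 * C / r ^ 2 * ‖z - a‖ ≤ 32 * C / r ^ 2 * η := by gcongr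
      have h3 := mem_closedBall_iff_norm.1 hkA
      have h4 := norm_sub_le_norm_sub_add_norm_sub (fderiv ℂ (F k) z) (fderiv ℂ (F k) a) A
      linarith
  have hsurj := happ.surjOn_closedBall_of_nonlinearRightInverse N hη0.le subset_rfl
  refine Subset.trans ?_ (hsurj.trans (image_mono (closedBall_subset_closedBall hηε)))
  refine closedBall_subset_closedBall' ?_
  rw [dist_comm]
  have := mem_closedBall.1 hka
  rw [show (N.nnnorm : ℝ)⁻¹ - c = c by rw [hc']; ring]
  linarith

end BoundedHolomorphic

/-! ### Hurwitz's theorem and nondegeneracy of limits. -/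

section Hurwitz

open Filter Topology

variable {ι E E' G : Type*} [NormedAddCommGroup E] [NormedSpace ℂ E]
  [NormedAddCommGroup E'] [NormedSpace ℂ E'] [NormedAddCommGroup G] [NormedSpace ℂ G]

/-- A finite subcover turns local uniformity, expressed by `l ×ˢ 𝓝 x`, into uniformity on `K`. -/
theorem IsCompact.eventually_forall_of_eventually_prod_nhds {X : Type*} [TopologicalSpace X]
    {l : Filter ι} {K : Set X} (hK : IsCompact K) {P : ι → X → Prop}
    (h : ∀ x ∈ K, ∀ᶠ p in l ×ˢ 𝓝 x, P p.1 p.2) : ∀ᶠ k in l, ∀ x ∈ K, P k x := by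
  refine hK.induction_on (p := fun s => ∀ᶠ k in l, ∀ x ∈ s, P k x) (by simp)
    (fun s t hst ht => ht.mono fun k hk x hx => hk x (hst hx))
    (fun s t hs ht => (hs.and ht).mono fun k hk x hx => hx.elim (hk.1 x) (hk.2 x))
    fun x hx => ?_
  obtain ⟨p, hp, q, hq, hpq⟩ := Filter.eventually_prod_iff.1 (h x hx)
  exact ⟨{y | q y}, mem_nhdsWithin_of_mem_nhds hq, hp.mono fun k hk y hy => hpq hk hy⟩

theorem EventuallyBoundedHolomorphicAt.comp {l : Filter ι} {F : ι → E → G} {g : E' → E} {a : E'}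
    (h : EventuallyBoundedHolomorphicAt l F (g a)) (hg : Differentiable ℂ g) :
    EventuallyBoundedHolomorphicAt l (fun k z => F k (g z)) a := by
  obtain ⟨r, hr, C, h⟩ := h
  obtain ⟨ρ, hρ, hsub⟩ := Metric.isOpen_iff.1 (isOpen_ball.preimage hg.continuous) a
    (mem_ball_self hr : g a ∈ ball (g a) r)
  exact ⟨ρ, hρ, C, h.mono fun k hk =>
    ⟨hk.1.comp hg.differentiableOn hsub, fun z hz => hk.2 _ (hsub hz)⟩⟩

theorem EventuallyBoundedHolomorphicAt.eventually_differentiableAt {l : Filter ι} {F : ι → E → G}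
    {a : E} (h : EventuallyBoundedHolomorphicAt l F a) :
    ∀ᶠ p in l ×ˢ 𝓝 a, DifferentiableAt ℂ (F p.1) p.2 := by
  obtain ⟨r, hr, C, h⟩ := h
  filter_upwards [h.prod_mk (ball_mem_nhds a hr)] with p hp
  exact hp.1.1.differentiableAt (isOpen_ball.mem_nhds hp.2)

theorem EventuallyBoundedHolomorphicAt.differentiableOn [FiniteDimensional ℂ E]
    [FiniteDimensional ℂ G] {𝒰 : Ultrafilter ι} {F : ι → E → G} {f : E → G} {U : Set E}
    (hU : IsOpen U) (h : ∀ a ∈ U, EventuallyBoundedHolomorphicAt (𝒰 : Filter ι) F a)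
    (hf : ∀ a ∈ U, Tendsto (fun k => F k a) 𝒰 (𝓝 (f a))) : DifferentiableOn ℂ f U :=
  fun a ha => ((h a ha).differentiableAt_and_tendsto_fderiv
    (mem_of_superset (hU.mem_nhds ha) hf)).1.differentiableWithinAt

/-- A form of Hurwitz's theorem on a disc. -/
theorem limit_ne_zero_of_ball {𝒰 : Ultrafilter ι} {F : ι → ℂ → ℂ} {f : ℂ → ℂ}
    (h : ∀ t ∈ ball (0 : ℂ) 2, EventuallyBoundedHolomorphicAt (𝒰 : Filter ι) F t)
    (hf : ∀ t ∈ ball (0 : ℂ) 2, Tendsto (fun k => F k t) 𝒰 (𝓝 (f t)))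
    (h0 : ∀ t ∈ ball (0 : ℂ) 2, ∀ᶠ p in (𝒰 : Filter ι) ×ˢ 𝓝 t, F p.1 p.2 ≠ 0)
    (h1 : f 1 ≠ 0) : f 0 ≠ 0 := by
  have hd : DifferentiableOn ℂ f (ball 0 2) :=
    EventuallyBoundedHolomorphicAt.differentiableOn isOpen_ball h hf
  have han : AnalyticOnNhd ℂ f (ball 0 2) := hd.analyticOnNhd isOpen_ball
  have hmem0 : (0 : ℂ) ∈ ball (0 : ℂ) 2 := by simp
  have hmem1 : (1 : ℂ) ∈ ball (0 : ℂ) 2 := by simp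
  -- By the identity theorem and `f 1 ≠ 0`, zeros at the origin are isolated, so some small circle
  -- avoids them.
  obtain ⟨r, hr0, hr2, hrS⟩ : ∃ r > 0, r < 2 ∧ ∀ t ∈ sphere (0 : ℂ) r, f t ≠ 0 := by
    rcases (han 0 hmem0).eventually_eq_zero_or_eventually_ne_zero with hz | hz
    · exact absurd (han.eqOn_zero_of_preconnected_of_eventuallyEq_zero
        (convex_ball 0 2).isPreconnected hmem0 hz hmem1) h1
    · obtain ⟨ε, hε, hεs⟩ := Metric.mem_nhdsWithin_iff.1 hz
      have hm : 0 < min ε 2 := lt_min hε two_pos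
      refine ⟨min ε 2 / 2, by positivity, by linarith [min_le_right ε 2], fun t ht => hεs ⟨?_, ?_⟩⟩
      · rw [mem_sphere] at ht
        rw [mem_ball, ht]
        linarith [min_le_left ε 2]
      · rintro rfl
        simp at ht
        linarith
  have hsub : closedBall (0 : ℂ) r ⊆ ball 0 2 := closedBall_subset_ball hr2
  have hcont : ContinuousOn (fun t => ‖f t‖) (sphere 0 r) :=
    (hd.continuousOn.mono (sphere_subset_closedBall.trans hsub)).norm
  obtain ⟨t₀, ht₀, hmin⟩ := (isCompact_sphere (0 : ℂ) r).exists_isMinOn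
    (NormedSpace.sphere_nonempty.2 hr0.le) hcont
  set δ := ‖f t₀‖ with hδ
  have hδ0 : 0 < δ := norm_pos_iff.2 (hrS t₀ ht₀)
  have hS : ∀ᶠ k in (𝒰 : Filter ι), ∀ t ∈ sphere (0 : ℂ) r, δ / 2 < ‖F k t‖ := by
    refine (isCompact_sphere (0 : ℂ) r).eventually_forall_of_eventually_prod_nhds fun t ht => ?_
    have ht2 := hsub (sphere_subset_closedBall ht)
    refine ((h t ht2).tendsto_prod (hf t ht2)).norm.eventually_const_lt ?_
    have : δ ≤ ‖f t‖ := hmin ht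
    linarith
  have hB : ∀ᶠ k in (𝒰 : Filter ι), ∀ t ∈ closedBall (0 : ℂ) r,
      F k t ≠ 0 ∧ DifferentiableAt ℂ (F k) t :=
    (isCompact_closedBall (0 : ℂ) r).eventually_forall_of_eventually_prod_nhds fun t ht =>
      (h0 t (hsub ht)).and (h t (hsub ht)).eventually_differentiableAt
  have hlow : ∀ᶠ k in (𝒰 : Filter ι), δ / 2 ≤ ‖F k 0‖ := by
    filter_upwards [hS, hB] with k hkS hkB
    -- The maximum principle for `1 / F k` carries the lower bound from the circle to the centre,
    -- uniformly in `k`.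
    have hd' : DiffContOnCl ℂ (fun t => (F k t)⁻¹) (ball 0 r) := by
      refine DifferentiableOn.diffContOnCl fun t ht => ?_
      have := hkB t (closure_ball_subset_closedBall ht)
      exact (this.2.inv this.1).differentiableWithinAt
    have := Complex.norm_le_of_forall_mem_frontier_norm_le (C := (δ / 2)⁻¹) isBounded_ball hd'
      (fun t ht => ?_) (subset_closure (mem_ball_self hr0))
    · rw [norm_inv] at this
      exact (inv_le_inv₀ (norm_pos_iff.2 (hkB 0 (mem_closedBall_self hr0.le)).1)
        (by positivity)).1 this
    · rw [norm_inv]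
      rw [frontier_ball _ hr0.ne'] at ht
      exact inv_anti₀ (by positivity) (hkS t ht).le
  have := ge_of_tendsto (hf 0 hmem0).norm hlow
  exact norm_pos_iff.1 (by linarith)

/-- **Hurwitz's theorem** in several variables: a limit of zero-free holomorphic functions on a
connected open set which does not vanish at one point is zero-free. -/
theorem limit_ne_zero_of_isPreconnected [FiniteDimensional ℂ E] {𝒰 : Ultrafilter ι}
    {F : ι → E → ℂ} {f : E → ℂ} {U : Set E} (hU : IsOpen U) (hUc : IsPreconnected U)
    (h : ∀ a ∈ U, EventuallyBoundedHolomorphicAt (𝒰 : Filter ι) F a)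
    (hf : ∀ a ∈ U, Tendsto (fun k => F k a) 𝒰 (𝓝 (f a)))
    (h0 : ∀ a ∈ U, ∀ᶠ p in (𝒰 : Filter ι) ×ˢ 𝓝 a, F p.1 p.2 ≠ 0)
    {x : E} (hx : x ∈ U) (hfx : f x ≠ 0) : ∀ a ∈ U, f a ≠ 0 := by
  have hd : DifferentiableOn ℂ f U := EventuallyBoundedHolomorphicAt.differentiableOn hU h hf
  have hV : IsOpen (U ∩ f ⁻¹' {0}ᶜ) :=
    hd.continuousOn.isOpen_inter_preimage hU isOpen_compl_singleton
  -- By connectedness it suffices that the nonvanishing set is relatively closed in `U`.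
  refine fun a ha => ((hUc.subset_of_closure_inter_subset hV ⟨x, hx, hx, hfx⟩ ?_) ha).2
  rintro a ⟨hac, haU⟩
  refine ⟨haU, ?_⟩
  obtain ⟨R, hR, hRU⟩ := Metric.isOpen_iff.1 hU a haU
  obtain ⟨b, ⟨-, hb0⟩, hab⟩ := Metric.mem_closure_iff.1 hac (R / 2) (half_pos hR)
  -- Complex line with `g 0 = a` and `g 1 = b`; since `b` is within `R / 2` of `a`, the disc of
  -- radius `2` stays in `U`.
  let g : ℂ → E := fun t => a + t • (b - a)
  have hg : Differentiable ℂ g := by fun_prop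
  have hgU : ∀ t ∈ ball (0 : ℂ) 2, g t ∈ U := fun t ht => hRU (by
    rw [dist_comm, dist_eq_norm] at hab
    rw [mem_ball_zero_iff] at ht
    rw [mem_ball_iff_norm, add_sub_cancel_left, norm_smul]
    calc ‖t‖ * ‖b - a‖ ≤ 2 * ‖b - a‖ := by gcongr
      _ < R := by linarith)
  have := limit_ne_zero_of_ball (F := fun k t => F k (g t)) (f := fun t => f (g t))
    (fun t ht => (h _ (hgU t ht)).comp hg) (fun t ht => hf _ (hgU t ht))
    (fun t ht => (tendsto_id.prodMap (hg.continuous.tendsto t)).eventually (h0 _ (hgU t ht)))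
    (by simpa [g] using hb0)
  simpa [g] using this

theorem differentiableAt_det_fderiv_of_bounded_ball [FiniteDimensional ℂ E] {f : E → E} {a : E}
    {r C : ℝ} (hr : 0 < r) (hd : DifferentiableOn ℂ f (ball a r))
    (hC : ∀ z ∈ ball a r, ‖f z‖ ≤ C) : DifferentiableAt ℂ (fun z => (fderiv ℂ f z).det) a := by
  let b := Module.finBasis ℂ E
  have hdet : ∀ z, (fderiv ℂ f z).det = Matrix.det (Matrix.of fun i j =>
      LinearMap.toContinuousLinearMap (b.coord i) (fderiv ℂ f z (b j))) := fun z => by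
    rw [ContinuousLinearMap.det, ← LinearMap.det_toMatrix b]
    congr 1
    ext i j
    simp [LinearMap.toMatrix_apply]
  simp only [hdet, Matrix.det_apply']
  refine DifferentiableAt.fun_sum fun σ _ => DifferentiableAt.const_mul
    (HasFDerivAt.finsetProd fun i _ => DifferentiableAt.hasFDerivAt ?_).differentiableAt _
  exact (LinearMap.toContinuousLinearMap (b.coord (σ i))).differentiableAt.comp a
    (differentiableAt_fderiv_apply_of_bounded_ball hr hd hC (b i))

/-- Cauchy estimates keep the derivatives in a compact ball of operators, where `det` is bounded. -/
theorem EventuallyBoundedHolomorphicAt.det_fderiv [FiniteDimensional ℂ E] {l : Filter ι}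
    {F : ι → E → E} {a : E} (h : EventuallyBoundedHolomorphicAt l F a) :
    EventuallyBoundedHolomorphicAt l (fun k z => (fderiv ℂ (F k) z).det) a := by
  obtain ⟨r, hr, C, h⟩ := h
  have : ProperSpace (E →L[ℂ] E) := FiniteDimensional.proper ℂ _
  obtain ⟨M, hM⟩ := (isCompact_closedBall
    (0 : E →L[ℂ] E) (2 * C / (r / 2))).exists_bound_of_continuousOn
    ContinuousLinearMap.continuous_det.continuousOn
  have hsub : ∀ w ∈ ball a (r / 2), ball w (r / 2) ⊆ ball a r := fun w hw =>
    ball_subset_ball' (by linarith [mem_ball.1 hw])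
  refine ⟨r / 2, half_pos hr, M, h.mono fun k hk => ⟨fun z hz => ?_, fun z hz => hM _ ?_⟩⟩
  · exact (differentiableAt_det_fderiv_of_bounded_ball (half_pos hr) (hk.1.mono (hsub z hz))
      fun w hw => hk.2 w (hsub z hz hw)).differentiableWithinAt
  · rw [mem_closedBall_zero_iff]
    exact norm_fderiv_le_of_bounded_ball (half_pos hr) (hk.1.mono (hsub z hz))
      fun w hw => hk.2 w (hsub z hz hw)

theorem ContinuousLinearMap.det_ne_zero_iff_injective [FiniteDimensional ℂ E] (A : E →L[ℂ] E) :
    A.det ≠ 0 ↔ Function.Injective A := by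
  rw [ContinuousLinearMap.det, ← isUnit_iff_ne_zero, ← LinearMap.isUnit_iff_isUnit_det,
    LinearMap.isUnit_iff_ker_eq_bot, LinearMap.ker_eq_bot]
  rfl

theorem ContinuousLinearMap.exists_equiv_of_injective [FiniteDimensional ℂ E] (A : E →L[ℂ] E)
    (hA : Function.Injective A) : ∃ e : E ≃L[ℂ] E, (e : E →L[ℂ] E) = A :=
  ⟨(LinearEquiv.ofInjectiveEndo (A : E →ₗ[ℂ] E) hA).toContinuousLinearEquiv, by ext; rfl⟩

/-- A limit of holomorphic immersions between equidimensional spaces, immersive at one point of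
a connected open set, is an immersion. -/
theorem injective_fderiv_of_isPreconnected [FiniteDimensional ℂ E] {𝒰 : Ultrafilter ι}
    {F : ι → E → E} {f : E → E} {U : Set E} (hU : IsOpen U) (hUc : IsPreconnected U)
    (h : ∀ a ∈ U, EventuallyBoundedHolomorphicAt (𝒰 : Filter ι) F a)
    (hf : ∀ a ∈ U, Tendsto (fun k => F k a) 𝒰 (𝓝 (f a)))
    (h0 : ∀ a ∈ U, ∀ᶠ p in (𝒰 : Filter ι) ×ˢ 𝓝 a, Function.Injective (fderiv ℂ (F p.1) p.2))
    {x : E} (hx : x ∈ U) (hfx : Function.Injective (fderiv ℂ f x)) :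
    ∀ a ∈ U, Function.Injective (fderiv ℂ f a) := by
  simp only [← ContinuousLinearMap.det_ne_zero_iff_injective] at *
  exact limit_ne_zero_of_isPreconnected hU hUc (fun a ha => (h a ha).det_fderiv)
    (fun a ha => (ContinuousLinearMap.continuous_det.tendsto _).comp
      ((h a ha).differentiableAt_and_tendsto_fderiv (mem_of_superset (hU.mem_nhds ha) hf)).2)
    h0 hx hfx

/-- The values of a limit immersion are attained nearby by the approximating maps. -/
theorem closedBall_subset_image_of_injective_fderiv [FiniteDimensional ℂ E] {𝒰 : Ultrafilter ι}
    {F : ι → E → E} {f : E → E} {U : Set E} (hU : IsOpen U)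
    (h : ∀ a ∈ U, EventuallyBoundedHolomorphicAt (𝒰 : Filter ι) F a)
    (hf : ∀ a ∈ U, Tendsto (fun k => F k a) 𝒰 (𝓝 (f a))) {a : E} (ha : a ∈ U)
    (hfa : Function.Injective (fderiv ℂ f a)) {ε : ℝ} (hε : 0 < ε) :
    ∃ δ > 0, ∀ᶠ k in (𝒰 : Filter ι), closedBall (f a) δ ⊆ F k '' closedBall a ε := by
  obtain ⟨A, hA⟩ := ContinuousLinearMap.exists_equiv_of_injective _ hfa
  refine (h a ha).closedBall_subset_image A (hf a ha) ?_ hε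
  rw [hA]
  exact ((h a ha).differentiableAt_and_tendsto_fderiv (mem_of_superset (hU.mem_nhds ha) hf)).2

end Hurwitz

/-! ### Inverses of holomorphic embeddings, inner radii, and the easy direction of the equivalence.
-/

section Embeddings

open Filter Topology

variable {E : Type*} [NormedAddCommGroup E] [NormedSpace ℂ E]

theorem fderiv_comp_fderiv_eq_id {f g : E → E} {a : E} (hf : DifferentiableAt ℂ f a)
    (hg : DifferentiableAt ℂ g (f a)) (h : ∀ᶠ z in 𝓝 a, g (f z) = z) :
    (fderiv ℂ g (f a)).comp (fderiv ℂ f a) = ContinuousLinearMap.id ℂ E := by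
  have h1 := hg.hasFDerivAt.comp a hf.hasFDerivAt
  exact (h1.congr_of_eventuallyEq (f₁ := id) (h.mono fun z hz => hz.symm)).unique (hasFDerivAt_id a)

theorem injective_fderiv_of_eventually_leftInverse {f g : E → E} {a : E}
    (hf : DifferentiableAt ℂ f a) (hg : DifferentiableAt ℂ g (f a))
    (h : ∀ᶠ z in 𝓝 a, g (f z) = z) : Function.Injective (fderiv ℂ f a) := by
  refine Function.LeftInverse.injective (g := fderiv ℂ g (f a)) fun v => ?_
  exact DFunLike.congr_fun (fderiv_comp_fderiv_eq_id hf hg h) v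

variable {n : ℕ} {D Ω : Set (EuclideanSpace ℂ (Fin n))}
  {f g : EuclideanSpace ℂ (Fin n) → EuclideanSpace ℂ (Fin n)}

theorem isOpenEmbedding_domRestrict_of_image_mem_nhds (hD : IsOpen D) (hc : ContinuousOn f D)
    (hi : InjOn f D) (ho : ∀ a ∈ D, ∀ V ∈ 𝓝 a, f '' V ∈ 𝓝 (f a)) :
    Topology.IsOpenEmbedding (D.domRestrict f) := by
  refine .of_continuous_injective_isOpenMap hc.domRestrict (injOn_iff_injective.1 hi) ?_
  refine isOpenMap_iff_nhds_le.2 fun a V hV => ?_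
  obtain ⟨W, hW, hWV⟩ := mem_nhds_subtype _ _ _ |>.1 (mem_map.1 hV)
  refine mem_of_superset (ho a a.2 (W ∩ D) (inter_mem hW (hD.mem_nhds a.2))) ?_
  rintro _ ⟨z, ⟨hzW, hzD⟩, rfl⟩
  exact hWV (show (⟨z, hzD⟩ : D) ∈ Subtype.val ⁻¹' W from hzW)

namespace IsHolomorphicEmbedding

theorem injOn (hf : IsHolomorphicEmbedding D Ω f) : InjOn f D :=
  injOn_iff_injective.2 hf.isOpenEmbedding.injective

theorem isOpen_image (hf : IsHolomorphicEmbedding D Ω f) : IsOpen (f '' D) := by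
  simpa [range_domRestrict] using hf.isOpenEmbedding.isOpen_range

theorem image_mem_nhds (hf : IsHolomorphicEmbedding D Ω f) {a : EuclideanSpace ℂ (Fin n)}
    (ha : a ∈ D) {V : Set (EuclideanSpace ℂ (Fin n))} (hV : V ∈ 𝓝 a) : f '' V ∈ 𝓝 (f a) := by
  have := hf.isOpenEmbedding.isOpenMap.image_mem_nhds (x := ⟨a, ha⟩)
    (preimage_coe_mem_nhds_subtype.2 (mem_nhdsWithin_of_mem_nhds hV))
  refine mem_of_superset this ?_
  rintro _ ⟨z, hz, rfl⟩
  exact ⟨z, hz, rfl⟩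

theorem differentiableOn_invFunOn (hD : IsOpen D) (hf : IsHolomorphicEmbedding D Ω f) :
    DifferentiableOn ℂ (Function.invFunOn f D) (f '' D) := by
  rintro _ ⟨a, ha, rfl⟩
  have hga : Function.invFunOn f D (f a) = a := hf.injOn.leftInvOn_invFunOn ha
  obtain ⟨A, hA⟩ := ContinuousLinearMap.exists_equiv_of_injective _ (hf.immersive a ha)
  have hcont : ContinuousAt (Function.invFunOn f D) (f a) := by
    rw [ContinuousAt, hga]
    intro V hV
    rw [mem_map]
    refine mem_of_superset (hf.image_mem_nhds ha (inter_mem hV (hD.mem_nhds ha))) ?_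
    rintro _ ⟨z, ⟨hzV, hzD⟩, rfl⟩
    rw [mem_preimage, hf.injOn.leftInvOn_invFunOn hzD]
    exact hzV
  refine (HasFDerivAt.of_local_left_inverse
    (f := f) (f' := A) hcont ?_ ?_).differentiableAt.differentiableWithinAt
  · rw [hga, hA]
    exact (hf.holomorphic.differentiableAt (hD.mem_nhds ha)).hasFDerivAt
  · exact mem_of_superset (hf.isOpen_image.mem_nhds (mem_image_of_mem f ha))
      fun w hw => Function.invFunOn_eq hw

theorem holomorphicallyEquivalent_image (hD : IsOpen D) (hf : IsHolomorphicEmbedding D Ω f) :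
    HolomorphicallyEquivalent D (f '' D) :=
  ⟨f, Function.invFunOn f D, hf.holomorphic, hf.differentiableOn_invFunOn hD, mapsTo_image f D,
    fun _ hw => Function.invFunOn_mem hw,
    hf.injOn.leftInvOn_invFunOn, fun _ hw => Function.invFunOn_eq hw⟩

end IsHolomorphicEmbedding

theorem isHolomorphicEmbedding_of_invOn (hD : IsOpen D) (hΩ : IsOpen Ω)
    (hf : DifferentiableOn ℂ f D) (hg : DifferentiableOn ℂ g Ω) (hfm : MapsTo f D Ω)
    (h : InvOn g f D Ω) : IsHolomorphicEmbedding D Ω f := by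
  refine ⟨hf, fun z hz => ?_, ?_, hfm⟩
  · exact injective_fderiv_of_eventually_leftInverse (hf.differentiableAt (hD.mem_nhds hz))
      (hg.differentiableAt (hΩ.mem_nhds (hfm hz))) (mem_of_superset (hD.mem_nhds hz) h.1)
  · refine isOpenEmbedding_domRestrict_of_image_mem_nhds hD hf.continuousOn h.1.injOn
      fun a ha V hV => ?_
    have hga := (hg.differentiableAt (hΩ.mem_nhds (hfm ha))).continuousAt
    rw [ContinuousAt, h.1 ha] at hga
    filter_upwards [hga hV, hΩ.mem_nhds (hfm ha)] with w hw hwΩ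
    exact ⟨g w, hw, h.2 hwΩ⟩

theorem ball_innerRadius_subset : ball 0 (innerRadius D f) ⊆ f '' D := by
  intro w hw
  rw [mem_ball_zero_iff] at hw
  obtain ⟨r, hr, hwr⟩ := exists_lt_of_lt_csSup ⟨0, by simp⟩ hw
  exact hr (mem_ball_zero_iff.2 hwr)

theorem innerRadius_pos (hn : 0 < n) {x : EuclideanSpace ℂ (Fin n)} (hx : x ∈ D)
    (hf : IsHolomorphicEmbedding D (ball 0 1) f) (hfx : f x = 0) : 0 < innerRadius D f := by
  obtain ⟨r, hr, hsub⟩ := Metric.isOpen_iff.1 hf.isOpen_image 0 ⟨x, hx, hfx⟩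
  exact hr.trans_le ((isLUB_innerRadius hn hf).1 hsub)

theorem squeezingFunction_eq_one_of_holomorphicallyEquivalent (hn : 0 < n) (hD : IsOpen D)
    (hDb : Bornology.IsBounded D) (h : HolomorphicallyEquivalent D (ball 0 1)) :
    ∃ x ∈ D, squeezingFunction D x = 1 := by
  obtain ⟨f, g, hf, hg, hfm, hgm, hinv⟩ := h
  have h0 : (0 : EuclideanSpace ℂ (Fin n)) ∈ ball (0 : EuclideanSpace ℂ (Fin n)) 1 :=
    mem_ball_self one_pos
  have hemb := isHolomorphicEmbedding_of_invOn hD isOpen_ball hf hg hfm hinv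
  have hlub := isLUB_squeezingFunction hn hD hDb (g 0)
  refine ⟨g 0, hgm h0, le_antisymm (hlub.2 ?_) ?_⟩
  · rintro _ ⟨f', hf', -, rfl⟩
    exact innerRadius_le_one hn hf'
  · refine le_trans ?_ (hlub.1 ⟨f, hemb, hinv.2 h0, rfl⟩)
    exact (isLUB_innerRadius hn hemb).1 fun w hw => ⟨g w, hgm hw, hinv.2 hw⟩

end Embeddings

/-! ### Existence of an extremal embedding. -/

section Extremal

open Filter Topology

variable {ι : Type*} {n : ℕ} {D : Set (EuclideanSpace ℂ (Fin n))}

/-- A limit of normalized embeddings whose images contain balls of radii exceeding every `r < s`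
is an embedding whose image contains the ball of radius `s`. -/
theorem exists_embedding_of_eventually_ball_subset {𝒰 : Ultrafilter ι}
    (hD : IsComplexDomain D) (hDb : Bornology.IsBounded D) {x : EuclideanSpace ℂ (Fin n)}
    (hx : x ∈ D) {F : ι → EuclideanSpace ℂ (Fin n) → EuclideanSpace ℂ (Fin n)}
    (hF : ∀ k, IsHolomorphicEmbedding D (ball 0 1) (F k)) (hFx : ∀ k, F k x = 0) {s : ℝ}
    (hs : 0 < s) (hball : ∀ r < s, ∀ᶠ k in (𝒰 : Filter ι), ball 0 r ⊆ F k '' D) :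
    ∃ f : EuclideanSpace ℂ (Fin n) → EuclideanSpace ℂ (Fin n),
      IsHolomorphicEmbedding D (ball 0 1) f ∧ f x = 0 ∧ ball 0 s ⊆ f '' D := by
  obtain ⟨hDo, hDc⟩ := hD
  have hFb : ∀ a ∈ D, EventuallyBoundedHolomorphicAt (𝒰 : Filter ι) F a := fun a ha => by
    obtain ⟨r, hr, hsub⟩ := Metric.isOpen_iff.1 hDo a ha
    exact ⟨r, hr, 1, .of_forall fun k => ⟨(hF k).holomorphic.mono hsub, fun z hz =>
      (mem_ball_zero_iff.1 ((hF k).mapsTo (hsub hz))).le⟩⟩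
  choose! f hf using fun a (ha : a ∈ D) => (hFb a ha).exists_tendsto
  set g : ι → EuclideanSpace ℂ (Fin n) → EuclideanSpace ℂ (Fin n) :=
    fun k => Function.invFunOn (F k) D with hg
  obtain ⟨R, hR⟩ := hDb.exists_norm_le
  have hgd : ∀ r < s, ∀ᶠ k in (𝒰 : Filter ι), DifferentiableOn ℂ (g k) (ball 0 r) ∧
      MapsTo (g k) (ball 0 r) D := fun r hr => (hball r hr).mono fun k hk =>
    ⟨((hF k).differentiableOn_invFunOn hDo).mono hk, fun w hw => Function.invFunOn_mem (hk hw)⟩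
  have hbetween : ∀ w ∈ ball (0 : EuclideanSpace ℂ (Fin n)) s, ∃ r < s, w ∈ ball 0 r :=
    fun w hw => by
      obtain ⟨r, hwr, hrs⟩ := exists_between (mem_ball_zero_iff.1 hw)
      exact ⟨r, hrs, mem_ball_zero_iff.2 hwr⟩
  have hgb : ∀ w ∈ ball (0 : EuclideanSpace ℂ (Fin n)) s,
      EventuallyBoundedHolomorphicAt (𝒰 : Filter ι) g w := fun w hw => by
    obtain ⟨r, hrs, hwr⟩ := hbetween w hw
    obtain ⟨ρ, hρ, hsub⟩ := Metric.isOpen_iff.1 isOpen_ball w hwr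
    exact ⟨ρ, hρ, R, (hgd r hrs).mono fun k hk => ⟨hk.1.mono hsub, fun z hz =>
      hR _ (hk.2 (hsub hz))⟩⟩
  choose! G hG using fun w (hw : w ∈ ball (0 : EuclideanSpace ℂ (Fin n)) s) =>
    (hgb w hw).exists_tendsto
  have hFnear : ∀ k, ∀ a ∈ D, ∀ᶠ z in 𝓝 a, g k (F k z) = z := fun k a ha =>
    mem_of_superset (hDo.mem_nhds ha) (hF k).injOn.leftInvOn_invFunOn
  have h0s : (0 : EuclideanSpace ℂ (Fin n)) ∈ ball (0 : EuclideanSpace ℂ (Fin n)) s :=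
    mem_ball_self hs
  have hfx : f x = 0 := tendsto_nhds_unique (hf x hx) (by simp [hFx])
  -- the derivatives of `f` at `x` and of `G` at `0` are inverse to each other
  have hf' := ((hFb x hx).differentiableAt_and_tendsto_fderiv
    (mem_of_superset (hDo.mem_nhds hx) hf)).2
  have hG' := ((hgb 0 h0s).differentiableAt_and_tendsto_fderiv
    (mem_of_superset (isOpen_ball.mem_nhds h0s) hG)).2
  have hcomp : (fderiv ℂ G 0).comp (fderiv ℂ f x) = ContinuousLinearMap.id ℂ _ := by
    refine tendsto_nhds_unique
      (((isBoundedBilinearMap_comp (𝕜 := ℂ)).continuous.tendsto _).comp (hG'.prodMk_nhds hf'))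
      (tendsto_const_nhds.congr fun k => ?_)
    simp only [Function.comp_apply]
    rw [← hFx k]
    refine (fderiv_comp_fderiv_eq_id ((hF k).holomorphic.differentiableAt (hDo.mem_nhds hx))
      (((hF k).differentiableOn_invFunOn hDo).differentiableAt
        ((hF k).isOpen_image.mem_nhds (mem_image_of_mem _ hx))) (hFnear k x hx)).symm
  have hfxi : Function.Injective (fderiv ℂ f x) :=
    Function.LeftInverse.injective (g := fderiv ℂ G 0) fun v => DFunLike.congr_fun hcomp v
  have hG0i : Function.Injective (fderiv ℂ G 0) := by
    refine LinearMap.injective_iff_surjective (f := (fderiv ℂ G 0).toLinearMap).2 ?_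
    exact Function.RightInverse.surjective (g := fderiv ℂ f x) fun v => DFunLike.congr_fun hcomp v
  -- Hurwitz spreads nondegeneracy from `x` to all of `D`; `hGi` does the same for `G`, starting
  -- from `0`.
  have hfi : ∀ a ∈ D, Function.Injective (fderiv ℂ f a) :=
    injective_fderiv_of_isPreconnected hDo hDc.isPreconnected hFb hf (fun a ha =>
      tendsto_snd.eventually (mem_of_superset (hDo.mem_nhds ha) fun z hz => hz) |>.mono
        fun p hp => (hF p.1).immersive _ hp) hx hfxi
  have hgi : ∀ w ∈ ball (0 : EuclideanSpace ℂ (Fin n)) s,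
      ∀ᶠ p in (𝒰 : Filter ι) ×ˢ 𝓝 w, Function.Injective (fderiv ℂ (g p.1) p.2) := fun w hw => by
    obtain ⟨r, hrs, hwr⟩ := hbetween w hw
    filter_upwards [((hgd r hrs).and (hball r hrs)).prod_mk (isOpen_ball.mem_nhds hwr)]
      with ⟨k, z⟩ ⟨⟨⟨hkd, hkm⟩, hkb⟩, hz⟩
    refine injective_fderiv_of_eventually_leftInverse (g := F k)
      (hkd.differentiableAt (isOpen_ball.mem_nhds hz))
      ((hF k).holomorphic.differentiableAt (hDo.mem_nhds (hkm hz))) ?_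
    filter_upwards [isOpen_ball.mem_nhds hz] with y hy
    exact Function.invFunOn_eq (hkb hy)
  have hGi : ∀ w ∈ ball (0 : EuclideanSpace ℂ (Fin n)) s, Function.Injective (fderiv ℂ G w) :=
    injective_fderiv_of_isPreconnected isOpen_ball (convex_ball 0 s).isPreconnected hgb hG hgi
      h0s hG0i
  have hfd : DifferentiableOn ℂ f D := EventuallyBoundedHolomorphicAt.differentiableOn hDo hFb hf
  have hfle : ∀ a ∈ D, ‖f a‖ ≤ 1 := fun a ha => le_of_tendsto (hf a ha).norm
    (.of_forall fun k => (mem_ball_zero_iff.1 ((hF k).mapsTo ha)).le)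
  -- Openness of `f` is the covering lemma for the constant family `fun _ => f`.
  have hopen : ∀ a ∈ D, ∀ V ∈ 𝓝 a, f '' V ∈ 𝓝 (f a) := fun a ha V hV => by
    obtain ⟨ε, hε, hεV⟩ := nhds_basis_closedBall.mem_iff.1 hV
    obtain ⟨δ, hδ, h⟩ := closedBall_subset_image_of_injective_fderiv (𝒰 := 𝒰) (F := fun _ => f)
      hDo (fun b hb => eventuallyBoundedHolomorphicAt_const _ hDo hb hfd hfle)
      (fun b _ => tendsto_const_nhds) ha (hfi a ha) hε
    obtain ⟨k, hk⟩ := h.exists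
    exact mem_of_superset (closedBall_mem_nhds _ hδ) (hk.trans (image_mono hεV))
  -- If `f a = f b`, a single late `F k` takes this common value in each of two disjoint balls,
  -- contradicting its injectivity.
  have hinj : InjOn f D := by
    intro a ha b hb hab
    by_contra hne
    have hd : 0 < dist a b := dist_pos.2 hne
    obtain ⟨ε, hε, hεa, hεb, hεd⟩ : ∃ ε > 0, closedBall a ε ⊆ D ∧ closedBall b ε ⊆ D ∧
        ε + ε < dist a b := by
      obtain ⟨ε₁, h₁, h₁'⟩ := nhds_basis_closedBall.mem_iff.1 (hDo.mem_nhds ha)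
      obtain ⟨ε₂, h₂, h₂'⟩ := nhds_basis_closedBall.mem_iff.1 (hDo.mem_nhds hb)
      refine ⟨min (dist a b / 3) (min ε₁ ε₂), by positivity,
        (closedBall_subset_closedBall (by simp)).trans h₁',
        (closedBall_subset_closedBall (by simp)).trans h₂', ?_⟩
      linarith [min_le_left (dist a b / 3) (min ε₁ ε₂)]
    obtain ⟨δ, hδ, h₁⟩ := closedBall_subset_image_of_injective_fderiv hDo hFb hf ha (hfi a ha) hε
    obtain ⟨δ', hδ', h₂⟩ := closedBall_subset_image_of_injective_fderiv hDo hFb hf hb (hfi b hb) hε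
    obtain ⟨k, hk₁, hk₂⟩ := (h₁.and h₂).exists
    obtain ⟨y, hy, hyk⟩ := hk₁ (mem_closedBall_self hδ.le)
    obtain ⟨z, hz, hzk⟩ := hk₂ (mem_closedBall_self hδ'.le)
    have hyz : y = z := (hF k).injOn (hεa hy) (hεb hz) (by rw [hyk, hzk, hab])
    subst hyz
    exact (closedBall_disjoint_closedBall hεd).le_bot ⟨hy, hz⟩
  refine ⟨f, ⟨hfd, hfi, isOpenEmbedding_domRestrict_of_image_mem_nhds hDo hfd.continuousOn hinj
    hopen, fun a ha => ?_⟩, hfx, fun w hw => ?_⟩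
  -- The limit only gives `‖f‖ ≤ 1`; openness of `f` makes the inequality strict.
  · rw [← interior_closedBall _ one_ne_zero]
    refine mem_interior_iff_mem_nhds.2 (mem_of_superset (hopen a ha D (hDo.mem_nhds ha)) ?_)
    rintro _ ⟨z, hz, rfl⟩
    exact mem_closedBall_zero_iff.2 (hfle z hz)
  · obtain ⟨r, hrs, hwr⟩ := hbetween w hw
    -- A limit of points of `D` might lie on its boundary. The covering lemma excludes this: `G w`
    -- is itself a value `g k y` with `y` near `w`.
    have hGw : G w ∈ D := by
      obtain ⟨ε, hε, hεr⟩ := nhds_basis_closedBall.mem_iff.1 (isOpen_ball.mem_nhds hwr)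
      obtain ⟨δ, hδ, h⟩ :=
        closedBall_subset_image_of_injective_fderiv isOpen_ball hgb hG hw (hGi w hw) hε
      obtain ⟨k, hk, -, hkm⟩ := (h.and (hgd r hrs)).exists
      obtain ⟨y, hy, hyk⟩ := hk (mem_closedBall_self hδ.le)
      rw [← hyk]
      exact hkm (hεr hy)
    refine ⟨G w, hGw, ?_⟩
    -- Pointwise convergence would not allow the moving argument `g k w`; equicontinuity does.
    have h1 : Tendsto (fun k => F k (g k w)) 𝒰 (𝓝 (f (G w))) :=
      ((hFb _ hGw).tendsto_prod (hf _ hGw)).comp (tendsto_id.prodMk (hG w hw))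
    refine tendsto_nhds_unique h1 (tendsto_const_nhds.congr' ?_)
    filter_upwards [hball r hrs] with k hk
    exact (Function.invFunOn_eq (hk hwr)).symm

/-- A maximizing sequence is passed to the limit. Positivity of the supremum matters: it puts `0` in
the domain of the limit of the inverses. -/
theorem exists_extremal_embedding (hn : 0 < n) (hD : IsComplexDomain D)
    (hDb : Bornology.IsBounded D) {x : EuclideanSpace ℂ (Fin n)} (hx : x ∈ D) :
    ∃ f : EuclideanSpace ℂ (Fin n) → EuclideanSpace ℂ (Fin n),
      IsHolomorphicEmbedding D (ball 0 1) f ∧ f x = 0 ∧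
        ball 0 (squeezingFunction D x) ⊆ f '' D ∧ innerRadius D f = squeezingFunction D x := by
  have hlub := isLUB_squeezingFunction hn hD.1 hDb x
  have hne := innerRadii_nonempty hD.1 hDb x
  have hpos : 0 < squeezingFunction D x := by
    obtain ⟨_, f, hf, hfx, rfl⟩ := id hne
    exact (innerRadius_pos hn hx hf hfx).trans_le (hlub.1 ⟨f, hf, hfx, rfl⟩)
  obtain ⟨u, -, -, hu, hmem⟩ := hlub.exists_seq_monotone_tendsto hne
  choose F hF hFx hFu using hmem
  obtain ⟨f, hf, hfx, hfs⟩ := exists_embedding_of_eventually_ball_subset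
    (𝒰 := Ultrafilter.of atTop) hD hDb hx hF hFx hpos fun r hr => by
      filter_upwards [(Ultrafilter.of_le atTop) (hu.eventually_const_lt hr)] with k hk
      refine (ball_subset_ball (le_of_lt ?_)).trans ball_innerRadius_subset
      rwa [← hFu k]
  exact ⟨f, hf, hfx, hfs, le_antisymm (hlub.1 ⟨f, hf, hfx, rfl⟩) ((isLUB_innerRadius hn hf).1 hfs)⟩

end Extremal

theorem mainTheorem1 {n : ℕ} (hn : 0 < n) (D : Set (EuclideanSpace ℂ (Fin n)))
    (hD : IsComplexDomain D) (hDb : Bornology.IsBounded D) :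
    (∀ x ∈ D, ∃ f : EuclideanSpace ℂ (Fin n) → EuclideanSpace ℂ (Fin n),
      IsHolomorphicEmbedding D (ball 0 1) f ∧ f x = 0 ∧
        ball 0 (squeezingFunction D x) ⊆ f '' D ∧
        innerRadius D f = squeezingFunction D x) ∧
    ((∃ x ∈ D, squeezingFunction D x = 1) ↔
      HolomorphicallyEquivalent D (ball (0 : EuclideanSpace ℂ (Fin n)) 1)) := by
  refine ⟨fun x hx => exists_extremal_embedding hn hD hDb hx, ?_,
    squeezingFunction_eq_one_of_holomorphicallyEquivalent hn hD.1 hDb⟩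
  rintro ⟨x, hx, hs⟩
  obtain ⟨f, hf, -, hball, -⟩ := exists_extremal_embedding hn hD hDb hx
  rw [hs] at hball
  -- For radius `1` the image is squeezed between the unit ball and itself.
  rw [← hf.mapsTo.image_subset.antisymm hball]
  exact hf.holomorphicallyEquivalent_image hD.1
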